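/- A tree order is a partial order $X$ with a minimum element (its root) in which $\{y \mid y \le x\}$ is linearly ordered for every $x \in X$; a branch is a maximal linearly ordered subset. A branchwise-real tree order is a tree order in which every branch is order-isomorphic to a real interval (a single point being allowed) and any two points have a greatest lower bound. It is continuously gradable if there is a strictly monotone map $\ell \colon X \to \mathbb{R}$ such that for all $x < y$ in $X$ the restriction $\ell{\upharpoonright}[x,y] \colon [x,y] \to [\ell(x),\ell(y)]$ is an order isomorphism. A point $x \in X$ is a branching node if $\{y \mid y > x\}$ has more than one equivalence class under the relation "$y \sim_x z$ if and only if there is $w > x$ with $w \le y$ and $w \le z$". A twig is a maximal element, under inclusion, among the upwards-closed subsets of $X$ that are order-isomorphic to a real interval with more than one point. For a cardinal $\kappa$, $X$ is $\kappa$-wispy if it has fewer than $\kappa$ branching nodes and fewer than $\kappa$ twigs. A forcing poset is a partial order $\mathbb{P}$ with a maximum element. It is ccc if every set of pairwise incompatible elements is countable, where $p, q$ are incompatible if there is no $r \in \mathbb{P}$ with $r \le p$ and $r \le q$. A subset $D \subseteq \mathbb{P}$ is dense if for every $p \in \mathbb{P}$ there is $q \in D$ with $q \le p$. A filter is a non-empty,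 upwards-closed subset of $\mathbb{P}$ any two elements of which have a common lower bound in it. $\mathrm{MA}_\kappa$ is the statement that for every ccc forcing poset $\mathbb{P}$ and every collection $\mathcal{D}$ of at most $\kappa$ dense subsets of $\mathbb{P}$, there is a filter $G \subseteq \mathbb{P}$ which intersects every element of $\mathcal{D}$. Theorem 5.10. Let $\kappa$ be a cardinal and assume $\mathrm{MA}_\kappa$. Then every branchwise-real tree order with at most $\kappa$ branching nodes is continuously gradable. Consequently, every $\kappa$-wispy branchwise-real tree order is continuously gradable. -/

import Mathlib

universe u

open Cardinal

namespace TreeOrder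

/-- A tree order: every set of predecessors is linearly ordered, and there is a root. -/
structure IsTreeOrder (X : Type u) [PartialOrder X] : Prop where
  isChain_Iic : ∀ x : X, IsChain (· ≤ ·) (Set.Iic x)
  exists_root : ∃ r : X, ∀ x : X, r ≤ x

/-- A real interval is an order-convex subset of the real line; one-point intervals are
allowed. -/
def IsoToRealInterval {X : Type u} [PartialOrder X] (S : Set X) : Prop :=
  ∃ I : Set ℝ, I.OrdConnected ∧ Nonempty (S ≃o I)

/-- A branchwise-real tree order: every branch (maximal linearly ordered subset) is
order-isomorphic to a real interval, and any two points have a greatest lower bound. -/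
structure IsBranchwiseReal (X : Type u) [PartialOrder X] : Prop extends IsTreeOrder X where
  branch_iso : ∀ B : Set X, IsMaxChain (· ≤ ·) B → IsoToRealInterval B
  exists_meet : ∀ x y : X, ∃ m : X, IsGLB {x, y} m

/-- A strictly monotone `ℓ : X → ℝ` which restricts, for all `x < y`, to an order isomorphism
from `[x, y]` onto `[ℓ x, ℓ y]`. -/
def IsContinuousGrading {X : Type u} [PartialOrder X] (ℓ : X → ℝ) : Prop :=
  StrictMono ℓ ∧
    ∀ x y : X, x < y →
      ∃ e : Set.Icc x y ≃o Set.Icc (ℓ x) (ℓ y), ∀ z : Set.Icc x y, (e z : ℝ) = ℓ z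

def ContinuouslyGradable (X : Type u) [PartialOrder X] : Prop :=
  ∃ ℓ : X → ℝ, IsContinuousGrading ℓ

/-- The relation `y ∼ₓ z` on the points strictly above `x`. -/
def ConnectedAbove {X : Type u} [PartialOrder X] (x : X) (y z : Set.Ioi x) : Prop :=
  ∃ w : X, x < w ∧ w ≤ y ∧ w ≤ z

theorem IsTreeOrder.equivalence_connectedAbove {X : Type u} [PartialOrder X]
    (hX : IsTreeOrder X) (x : X) : Equivalence (ConnectedAbove x) where
  refl y := ⟨y, y.2, le_rfl, le_rfl⟩
  symm := fun ⟨w, h, h₁, h₂⟩ => ⟨w, h, h₂, h₁⟩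
  trans := by
    rintro a b c ⟨v, hv, hva, hvb⟩ ⟨w, hw, hwb, hwc⟩
    rcases (hX.isChain_Iic b).total hvb hwb with h | h
    · exact ⟨v, hv, hva, h.trans hwc⟩
    · exact ⟨w, hw, h.trans hva, hwc⟩

/-- The `x`-connected components: the equivalence classes of `∼ₓ`. -/
def components {X : Type u} [PartialOrder X] (x : X) : Set (Set (Set.Ioi x)) :=
  {C | ∃ y : Set.Ioi x, C = {z | ConnectedAbove x y z}}

/-- The degree of `x`: the number of `x`-connected components. -/
noncomputable def degree {X : Type u} [PartialOrder X] (x : X) : Cardinal.{u} :=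
  #(components x)

/-- The set of branching nodes. -/
def branchingNodes (X : Type u) [PartialOrder X] : Set X :=
  {x | 1 < degree x}

/-- A twig: a subset maximal (under inclusion) among the upwards-closed subsets
order-isomorphic to a real interval with more than one point. -/
def IsTwig {X : Type u} [PartialOrder X] (S : Set X) : Prop :=
  Maximal (fun S : Set X => IsUpperSet S ∧ S.Nontrivial ∧ IsoToRealInterval S) S

/-- Fewer than `κ` branching nodes and fewer than `κ` twigs. -/
def IsWispy (κ : Cardinal.{u}) (X : Type u) [PartialOrder X] : Prop :=
  #(branchingNodes X) < κ ∧ #{S : Set X // IsTwig S} < κ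

/-- The countable chain condition for forcing posets (which extend downwards): every set of
pairwise incompatible conditions is countable. -/
def ForcingCCC (P : Type u) [PartialOrder P] : Prop :=
  ∀ A : Set P, (∀ p ∈ A, ∀ q ∈ A, p ≠ q → ¬ ∃ r : P, r ≤ p ∧ r ≤ q) → A.Countable

/-- Martin's Axiom at `κ`: for every partial order with a greatest element satisfying the
countable chain condition and every collection of at most `κ` dense subsets (every condition has an extension in the
subset), some filter (non-empty, upwards-closed, downwards-directed) meets all of them. -/
def MartinsAxiom (κ : Cardinal.{u}) : Prop :=
  ∀ (P : Type u) [PartialOrder P] [OrderTop P], ForcingCCC P →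
    ∀ 𝒟 : Set (Set P), #𝒟 ≤ κ → (∀ D ∈ 𝒟, IsCoinitial D) →
      ∃ G : Order.PFilter P, ∀ D ∈ 𝒟, ∃ p ∈ D, p ∈ G

end TreeOrder

/-! Well-order all sets of points and let each point choose the least branch through it. The points
choosing a branch `b` form a terminal segment of `b`, and these segments partition the tree. Call
`b` and `b'` related (`Rel`) if some point choosing `b` lies below a point choosing `b' ≠ b`. The
predecessors of any branch are pairwise comparable. Chains are countable, because up to a last
element they embed as well-ordered sets of points in a single branch, hence in the reals
(`countable_of_pairwise_rel`). A branch with a successor is chosen by some branching node, so at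
most `κ` branches have one. Under Martin's Axiom such a relation is special
(`MartinsAxiom.exists_coloring`): forcing with finite colourings gives colours in `ℕ` that differ on
related branches. Let `g b` be the bounded height above the segment of `b`, measured along `b`, and
let `ℓ` be the sum of `2 ^ (-f b) * g b`. The heights positive at a given point belong to pairwise
related branches, so their colours differ and the sum converges uniformly below that point. This
gives continuity along intervals, and strictness holds because every interval contains a nontrivial
piece inside one segment. -/

namespace TreeOrder

/-! ### Specializing a tree-like relation by forcing. -/

open Filter in
/-- Among uncountably many partial colourings of length `k` whose colours agree and all of whose
coordinates are constant or countable-to-one, two are compatible. -/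
theorem exists_compatible_of_constant_or_countable {ι T : Type*} [Uncountable ι] {k : ℕ}
    {R : T → T → Prop} (hpred : ∀ a b c, R a c → R b c → a = b ∨ R a b ∨ R b a)
    (hchain : ∀ C : Set T, C.Pairwise (fun a b => R a b ∨ R b a) → C.Countable)
    (a : ι → Fin k → T) (n : Fin k → ℕ)
    (hfun : ∀ α i j, a α i = a α j → n i = n j)
    (hcol : ∀ α i j, R (a α i) (a α j) → n i ≠ n j)
    (hK : ∀ i, (∃ c, ∀ α, a α i = c) ∨ ∀ c, {α | a α i = c}.Countable) :
    ∃ α β, α ≠ β ∧ ∀ i j, (a α i = a β j → n i = n j) ∧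
      (R (a α i) (a β j) → n i ≠ n j) ∧ (R (a β j) (a α i) → n i ≠ n j) := by
  by_contra! h
  have hne : (cocountable : Filter ι).NeBot := by
    refine ⟨fun hbot => ?_⟩
    have h1 : (∅ : Set ι) ∈ (cocountable : Filter ι) := by rw [hbot]; exact mem_bot
    rw [mem_cocountable, Set.compl_empty] at h1
    exact Set.not_countable_univ h1
  -- No set in `U` is countable, and `U` picks one of finitely many alternatives for almost all `β`.
  let U : Ultrafilter ι := Ultrafilter.of cocountable
  have hU : ∀ A : Set ι, A ∈ U → ¬ A.Countable := by
    intro A hA hc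
    have : Aᶜ ∈ U := Ultrafilter.of_le _ (mem_cocountable.2 (by rwa [compl_compl]))
    exact Ultrafilter.compl_mem_iff_notMem.1 this hA
  have hconst : ∀ i (A : Set ι), ¬ A.Countable → ((fun α => a α i) '' A).Countable →
      ∃ c, ∀ α, a α i = c := by
    intro i A hA hc
    refine (hK i).resolve_right fun hf => hA ?_
    refine (hc.biUnion (fun c _ => hf c)).mono fun α hα => ?_
    exact Set.mem_biUnion (Set.mem_image_of_mem _ hα) rfl
  have key : ∀ α, ∃ i j, n i = n j ∧ ∀ᶠ β in U, R (a α i) (a β j) := by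
    intro α
    have h1 : ∀ᶠ β in (U : Filter ι), ∃ i j, (a α i = a β j ∧ n i ≠ n j) ∨
        (R (a α i) (a β j) ∧ n i = n j) ∨ (R (a β j) (a α i) ∧ n i = n j) := by
      have h2 : {α}ᶜ ∈ U :=
        Ultrafilter.of_le _ (mem_cocountable.2 (by simp))
      filter_upwards [h2] with β hβ
      obtain ⟨i, j, hij⟩ := h α β (fun e => hβ e.symm)
      refine ⟨i, j, ?_⟩
      tauto
    rw [Ultrafilter.eventually_exists_iff] at h1
    obtain ⟨i, h1⟩ := h1
    rw [Ultrafilter.eventually_exists_iff] at h1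
    obtain ⟨j, h1⟩ := h1
    rw [Ultrafilter.eventually_or, Ultrafilter.eventually_or] at h1
    rcases h1 with h1 | h1 | h1
    · exfalso
      obtain ⟨β, -, hn⟩ := h1.exists
      obtain ⟨c, hc⟩ := hconst j _ (hU _ h1) ((Set.countable_singleton (a α i)).mono (by
        rintro _ ⟨β, hβ, rfl⟩
        exact hβ.1.symm))
      obtain ⟨β, hβ, -⟩ := h1.exists
      exact hn (hfun α i j (by rw [hβ, hc, hc]))
    · obtain ⟨β, -, hn⟩ := h1.exists
      exact ⟨i, j, hn, h1.mono fun β hβ => hβ.1⟩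
    -- The values `a β j` are predecessors of one point, hence a countable chain. So coordinate `j`
    -- is constant, and `a α` itself violates `hcol`.
    · exfalso
      obtain ⟨β, -, hn⟩ := h1.exists
      obtain ⟨c, hc⟩ := hconst j _ (hU _ h1) (hchain _ (by
        rintro _ ⟨β, hβ, rfl⟩ _ ⟨γ, hγ, rfl⟩ hne
        exact (hpred _ _ _ hβ.1 hγ.1).resolve_left hne))
      obtain ⟨β, hβ, -⟩ := h1.exists
      refine hcol α j i ?_ hn.symm
      rwa [hc, ← hc β]
  choose i j hn hR using key
  obtain ⟨q, hq⟩ : ∃ q : Fin k × Fin k, ¬ {α | (i α, j α) = q}.Countable := by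
    by_contra! hc
    refine Set.not_countable_univ ((Set.countable_iUnion hc).mono fun α _ => ?_)
    exact Set.mem_iUnion.2 ⟨_, rfl⟩
  -- Two sets of `U` meet, so any two of these points lie below a common one. They form a countable
  -- chain, and coordinate `q.1` is constant.
  obtain ⟨c, hc⟩ := hconst q.1 _ hq (hchain _ (by
    rintro _ ⟨α, hα, rfl⟩ _ ⟨β, hβ, rfl⟩ hne
    obtain ⟨γ, h1, h2⟩ := ((hR α).and (hR β)).exists
    simp only [Set.mem_ofPred_eq, Prod.ext_iff] at hα hβ
    rw [hα.1, hα.2] at h1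
    rw [hβ.1, hβ.2] at h2
    exact (hpred _ _ _ h1 h2).resolve_left hne))
  obtain ⟨α, hα⟩ : {α | (i α, j α) = q}.Nonempty := by
    by_contra he
    rw [Set.not_nonempty_iff_eq_empty] at he
    exact hq (he ▸ Set.countable_empty)
  simp only [Set.mem_ofPred_eq, Prod.ext_iff] at hα
  obtain ⟨β, hβ⟩ := (hR α).exists
  refine hcol β (i α) (j α) ?_ (hn α)
  rwa [hα.1, hc, ← hc α, ← hα.1]

/-- Among uncountably many partial colourings of length `k` whose colours agree, two are
compatible. -/
theorem exists_compatible {ι T : Type*} [Uncountable ι] {k : ℕ}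
    {R : T → T → Prop} (hpred : ∀ a b c, R a c → R b c → a = b ∨ R a b ∨ R b a)
    (hchain : ∀ C : Set T, C.Pairwise (fun a b => R a b ∨ R b a) → C.Countable)
    (a : ι → Fin k → T) (n : Fin k → ℕ)
    (hfun : ∀ α i j, a α i = a α j → n i = n j)
    (hcol : ∀ α i j, R (a α i) (a α j) → n i ≠ n j) :
    ∃ α β, α ≠ β ∧ ∀ i j, (a α i = a β j → n i = n j) ∧
      (R (a α i) (a β j) → n i ≠ n j) ∧ (R (a β j) (a α i) → n i ≠ n j) := by
  -- This thinning, one coordinate at a time, plays the role of a Δ-system argument.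
  have hS : ∀ F : Finset (Fin k), ∃ S : Set ι, ¬ S.Countable ∧
      ∀ i ∈ F, (∃ c, ∀ α ∈ S, a α i = c) ∨ ∀ c, {α ∈ S | a α i = c}.Countable := by
    intro F
    induction F using Finset.induction_on with
    | empty => exact ⟨Set.univ, Set.not_countable_univ, by simp⟩
    | insert i F _ ih =>
      obtain ⟨S, hS, hF⟩ := ih
      by_cases hi : ∀ c, {α ∈ S | a α i = c}.Countable
      · refine ⟨S, hS, fun j hj => ?_⟩
        rcases Finset.mem_insert.1 hj with rfl | hj
        exacts [Or.inr hi, hF j hj]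
      · push Not at hi
        obtain ⟨c, hc⟩ := hi
        refine ⟨_, hc, fun j hj => ?_⟩
        rcases Finset.mem_insert.1 hj with rfl | hj
        · exact Or.inl ⟨c, fun α hα => hα.2⟩
        · refine (hF j hj).imp (fun ⟨d, hd⟩ => ⟨d, fun α hα => hd α hα.1⟩) fun h d => ?_
          exact (h d).mono (by rintro α ⟨⟨h1, -⟩, h2⟩; exact ⟨h1, h2⟩)
  obtain ⟨S, hS, hF⟩ := hS Finset.univ
  have : Uncountable S := by
    rw [← not_countable_iff]
    exact fun h => hS (Set.countable_coe_iff.1 h)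
  obtain ⟨α, β, hne, h⟩ := exists_compatible_of_constant_or_countable hpred hchain
    (fun α : S => a α) n (fun α => hfun α) (fun α => hcol α) (fun i => by
      refine (hF i (Finset.mem_univ i)).imp (fun ⟨c, hc⟩ => ⟨c, fun α => hc α α.2⟩) fun h c => ?_
      refine ((h c).preimage (f := ((↑) : S → ι)) Subtype.val_injective).mono ?_
      rintro α hα
      exact ⟨α.2, hα⟩)
  exact ⟨α, β, fun e => hne (Subtype.ext e), h⟩

/-- A finite partial colouring of `T` by natural numbers, as a graph, in which `R`-related points
get different colours. -/
def IsPartialColoring {T : Type*} (R : T → T → Prop) (p : Finset (T × ℕ)) : Prop :=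
  ∀ x ∈ p, ∀ y ∈ p, (x.1 = y.1 → x.2 = y.2) ∧ (R x.1 y.1 → x.2 ≠ y.2)

/-- The forcing poset of finite partial colourings. -/
abbrev PartialColoring {T : Type*} (R : T → T → Prop) : Type _ :=
  {p : Finset (T × ℕ) // IsPartialColoring R p}ᵒᵈ

instance {T : Type*} (R : T → T → Prop) :
    OrderBot {p : Finset (T × ℕ) // IsPartialColoring R p} where
  bot := ⟨∅, by simp [IsPartialColoring]⟩
  bot_le p := Finset.empty_subset p.1

/-- There are only countably many colour patterns `s`, so an uncountable antichain has uncountably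
many members with the same pattern. Two of them are compatible by `exists_compatible`, and their
union is a common extension. -/
theorem PartialColoring.forcingCCC {T : Type*}
    {R : T → T → Prop} (hpred : ∀ a b c, R a c → R b c → a = b ∨ R a b ∨ R b a)
    (hchain : ∀ C : Set T, C.Pairwise (fun a b => R a b ∨ R b a) → C.Countable) :
    ForcingCCC (PartialColoring R) := by
  classical
  intro A hA
  by_contra hunc
  let H : (Σ k : ℕ, Fin k → ℕ) → PartialColoring R → Prop := fun s p =>
    ∃ a : Fin s.1 → T, ∀ x, x ∈ (OrderDual.ofDual p).1 ↔ ∃ i, (a i, s.2 i) = x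
  obtain ⟨s, hs⟩ : ∃ s, ¬ {p ∈ A | H s p}.Countable := by
    by_contra! hc
    refine hunc ((Set.countable_iUnion hc).mono fun p hp => ?_)
    let e := (OrderDual.ofDual p).1.equivFin.symm
    refine Set.mem_iUnion.2 ⟨⟨_, fun i => (e i).1.2⟩, hp, fun i => (e i).1.1, fun x => ?_⟩
    refine ⟨fun hx => ⟨e.symm ⟨x, hx⟩, by simp⟩, ?_⟩
    rintro ⟨i, rfl⟩
    exact (e i).2
  have : Uncountable {p ∈ A | H s p} := by
    rw [← not_countable_iff]
    exact fun h => hs (Set.countable_coe_iff.1 h)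
  choose a ha using fun p : {p ∈ A | H s p} => p.2.2
  have hmem : ∀ p i, (a p i, s.2 i) ∈ (OrderDual.ofDual p.1).1 := fun p i =>
    (ha p _).2 ⟨i, rfl⟩
  obtain ⟨p, q, hpq, h⟩ := exists_compatible hpred hchain a s.2
    (fun p i j => ((OrderDual.ofDual p.1).2 _ (hmem p i) _ (hmem p j)).1)
    (fun p i j => ((OrderDual.ofDual p.1).2 _ (hmem p i) _ (hmem p j)).2)
  refine hA p.1 p.2.1 q.1 q.2.1 (fun e => hpq (Subtype.ext e)) ?_
  refine ⟨OrderDual.toDual ⟨(OrderDual.ofDual p.1).1 ∪ (OrderDual.ofDual q.1).1, ?_⟩,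
    Finset.subset_union_left, Finset.subset_union_right⟩
  intro x hx y hy
  rcases Finset.mem_union.1 hx with hx | hx <;> rcases Finset.mem_union.1 hy with hy | hy
  · exact (OrderDual.ofDual p.1).2 x hx y hy
  · obtain ⟨i, rfl⟩ := (ha p x).1 hx
    obtain ⟨j, rfl⟩ := (ha q y).1 hy
    exact ⟨(h i j).1, (h i j).2.1⟩
  · obtain ⟨i, rfl⟩ := (ha q x).1 hx
    obtain ⟨j, rfl⟩ := (ha p y).1 hy
    exact ⟨fun e => ((h j i).1 e.symm).symm, fun e => ((h j i).2.2 e).symm⟩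
  · exact (OrderDual.ofDual q.1).2 x hx y hy

/-- Under Martin's Axiom, a tree-like relation without uncountable chains on a set of size at most
`κ` is special: it has a colouring by natural numbers with `R`-independent colour classes. -/
theorem MartinsAxiom.exists_coloring {κ : Cardinal.{u}} (hMA : MartinsAxiom κ) {T : Type u}
    (hT : #T ≤ κ) {R : T → T → Prop} (hirr : ∀ a, ¬ R a a)
    (hpred : ∀ a b c, R a c → R b c → a = b ∨ R a b ∨ R b a)
    (hchain : ∀ C : Set T, C.Pairwise (fun a b => R a b ∨ R b a) → C.Countable) :
    ∃ f : T → ℕ, ∀ a b, R a b → f a ≠ f b := by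
  classical
  let D : T → Set (PartialColoring R) := fun a => {p | ∃ n, (a, n) ∈ (OrderDual.ofDual p).1}
  obtain ⟨G, hG⟩ := hMA (PartialColoring R) (PartialColoring.forcingCCC hpred hchain)
    (Set.range D) (mk_range_le.trans hT) (by
      rintro _ ⟨a, rfl⟩ p
      by_cases hp : ∃ n, (a, n) ∈ (OrderDual.ofDual p).1
      · exact ⟨p, hp, le_rfl⟩
      -- A colour not yet used cannot conflict with anything.
      obtain ⟨n, hn⟩ := Infinite.exists_notMem_finset ((OrderDual.ofDual p).1.image Prod.snd)
      have hn' : ∀ x ∈ (OrderDual.ofDual p).1, x.2 ≠ n := fun x hx e =>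
        hn (Finset.mem_image.2 ⟨x, hx, e⟩)
      have ha' : ∀ x ∈ (OrderDual.ofDual p).1, x.1 ≠ a := fun x hx e =>
        hp ⟨x.2, by rw [← e]; exact hx⟩
      refine ⟨OrderDual.toDual ⟨insert (a, n) (OrderDual.ofDual p).1, ?_⟩,
        ⟨n, Finset.mem_insert_self _ _⟩, Finset.subset_insert _ _⟩
      intro x hx y hy
      rcases Finset.mem_insert.1 hx with rfl | hx <;> rcases Finset.mem_insert.1 hy with rfl | hy
      · exact ⟨fun _ => rfl, fun h => (hirr _ h).elim⟩
      · exact ⟨fun e => (ha' y hy e.symm).elim, fun _ => (hn' y hy).symm⟩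
      · exact ⟨fun e => (ha' x hx e).elim, fun _ => hn' x hx⟩
      · exact (OrderDual.ofDual p).2 x hx y hy)
  have hG' : ∀ a, ∃ n, ∃ p ∈ G, (a, n) ∈ (OrderDual.ofDual p).1 := by
    intro a
    obtain ⟨p, ⟨n, hn⟩, hp⟩ := hG (D a) ⟨a, rfl⟩
    exact ⟨n, p, hp, hn⟩
  choose f p hp hf using hG'
  refine ⟨f, fun a b hab => ?_⟩
  obtain ⟨r, -, hra, hrb⟩ := G.directed (p a) (hp a) (p b) (hp b)
  exact ((OrderDual.ofDual r).2 _ (hra (hf a)) _ (hrb (hf b))).2 hab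

/-! ### Projections, coordinates and heights along branches. -/

section Branches

variable {X : Type u} [PartialOrder X]

theorem IsTreeOrder.mem_of_le (hX : IsTreeOrder X) {b : Set X} (hb : IsMaxChain (· ≤ ·) b)
    {m c : X} (hc : c ∈ b) (hmc : m ≤ c) : m ∈ b := by
  have h : IsChain (· ≤ ·) (insert m b) := hb.1.insert fun w hw _ => by
    rcases hb.1.total hc hw with h | h
    · exact Or.inl (hmc.trans h)
    · exact (hX.isChain_Iic c).total hmc h
  rw [hb.2 h (Set.subset_insert _ _)]
  exact Set.mem_insert _ _

theorem exists_mem_not_le_of_notMem {b : Set X} (hb : IsMaxChain (· ≤ ·) b) {x : X}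
    (hx : x ∉ b) : ∃ c ∈ b, ¬ c ≤ x := by
  by_contra! h
  have h' : IsChain (· ≤ ·) (insert x b) := hb.1.insert fun w hw _ => Or.inr (h w hw)
  exact hx (hb.2 h' (Set.subset_insert _ _) ▸ Set.mem_insert _ _)

/-- Every point has a projection to every branch. -/
theorem IsBranchwiseReal.exists_isGreatest (hX : IsBranchwiseReal X) {b : Set X}
    (hb : IsMaxChain (· ≤ ·) b) (x : X) : ∃ p, IsGreatest (b ∩ Set.Iic x) p := by
  by_cases hx : x ∈ b
  · exact ⟨x, ⟨hx, le_rfl⟩, fun w hw => hw.2⟩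
  obtain ⟨c, hc, hcx⟩ := exists_mem_not_le_of_notMem hb hx
  -- The projection is the meet with any point of the branch not below `x`.
  obtain ⟨m, hm⟩ := hX.exists_meet x c
  have hmx : m ≤ x := hm.1 (by simp)
  have hmc : m ≤ c := hm.1 (by simp)
  refine ⟨m, ⟨hX.mem_of_le hb hc hmc, hmx⟩, fun w hw => hm.2 ?_⟩
  have hwc : w ≤ c := (hb.1.total hw.1 hc).resolve_right fun h => hcx (h.trans hw.2)
  rintro z (rfl | rfl)
  exacts [hw.2, hwc]

theorem le_of_strictMonoOn {b : Set X} (hb : IsChain (· ≤ ·) b) {φ : X → ℝ}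
    (hφ : StrictMonoOn φ b) {x y : X} (hx : x ∈ b) (hy : y ∈ b) (h : φ x ≤ φ y) : x ≤ y :=
  (hb.total hx hy).elim id fun hyx =>
    (eq_of_le_of_not_lt hyx fun hlt => (hφ hy hx hlt).not_ge h).ge

/-- A branch has a bounded coordinate whose values form an interval. -/
theorem IsBranchwiseReal.exists_coordinate (hX : IsBranchwiseReal X) {b : Set X}
    (hb : IsMaxChain (· ≤ ·) b) : ∃ φ : X → ℝ, StrictMonoOn φ b ∧ (∀ x, φ x ∈ Set.Icc (-2) 2) ∧
      ∀ x ∈ b, ∀ y ∈ b, ∀ t ∈ Set.Icc (φ x) (φ y), ∃ z ∈ b, φ z = t := by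
  classical
  obtain ⟨I, hI, ⟨e⟩⟩ := hX.branch_iso b hb
  let φ : X → ℝ := fun x => if h : x ∈ b then Real.arctan (e ⟨x, h⟩) else 0
  have hφ : ∀ x (h : x ∈ b), φ x = Real.arctan (e ⟨x, h⟩) := fun x h => dif_pos h
  refine ⟨φ, fun x hx y hy hxy => ?_, fun x => ?_, fun x hx y hy t ht => ?_⟩
  · rw [hφ x hx, hφ y hy]
    refine Real.arctan_strictMono ?_
    exact e.strictMono (show (⟨x, hx⟩ : b) < ⟨y, hy⟩ from hxy)
  · by_cases h : x ∈ b
    · rw [hφ x h]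
      have h1 := Real.arctan_lt_pi_div_two (e ⟨x, h⟩)
      have h2 := Real.neg_pi_div_two_lt_arctan (e ⟨x, h⟩)
      have h3 := Real.pi_lt_four
      constructor <;> linarith
    · simp [φ, h]
  · rw [hφ x hx, hφ y hy] at ht
    have hxy : (e ⟨x, hx⟩ : ℝ) ≤ e ⟨y, hy⟩ := Real.arctan_le_arctan_iff.1 (ht.1.trans ht.2)
    obtain ⟨s, hs, rfl⟩ :=
      intermediate_value_Icc hxy Real.continuous_arctan.continuousOn ht
    have hsI : s ∈ I := hI.out (e ⟨x, hx⟩).2 (e ⟨y, hy⟩).2 hs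
    refine ⟨e.symm ⟨s, hsI⟩, (e.symm ⟨s, hsI⟩).2, ?_⟩
    rw [hφ _ (e.symm ⟨s, hsI⟩).2]
    simp

theorem IsTreeOrder.exists_branch (hX : IsTreeOrder X) (y : X) :
    ∃ b : Set X, IsMaxChain (· ≤ ·) b ∧ Set.Iic y ⊆ b :=
  (hX.isChain_Iic y).exists_maxChain

theorem IsBranchwiseReal.exists_parametrization (hX : IsBranchwiseReal X) {x y : X}
    (hxy : x ≤ y) : ∃ (u v : ℝ) (huv : u ≤ v) (γ : Set.Icc u v → X), StrictMono γ ∧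
      γ ⟨u, Set.left_mem_Icc.2 huv⟩ = x ∧ γ ⟨v, Set.right_mem_Icc.2 huv⟩ = y ∧
      ∀ z ∈ Set.Icc x y, ∃ r, γ r = z := by
  obtain ⟨b, hb, hyb⟩ := hX.exists_branch y
  obtain ⟨φ, hφ, -, hφI⟩ := hX.exists_coordinate hb
  have hx : x ∈ b := hyb hxy
  have hy : y ∈ b := hyb le_rfl
  choose γ hγb hγ using fun r : Set.Icc (φ x) (φ y) => hφI x hx y hy r r.2
  have hle' : ∀ {z w}, z ∈ b → w ∈ b → φ z ≤ φ w → z ≤ w := le_of_strictMonoOn hb.1 hφ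
  have huniq : ∀ r : Set.Icc (φ x) (φ y), ∀ z ∈ b, φ z = r → γ r = z := fun r z hz e =>
    le_antisymm (hle' (hγb r) hz ((hγ r).trans e.symm).le)
      (hle' hz (hγb r) (e.trans (hγ r).symm).le)
  have hle : φ x ≤ φ y := hφ.monotoneOn hx hy hxy
  refine ⟨φ x, φ y, hle, γ, fun r s hrs => ?_, huniq _ x hx rfl, huniq _ y hy rfl,
    fun z hz => ?_⟩
  · rcases hb.1.total (hγb s) (hγb r) with h | h
    · have h1 := hφ.monotoneOn (hγb s) (hγb r) h
      rw [hγ, hγ] at h1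
      exact absurd hrs (not_lt.2 h1)
    · refine lt_of_le_of_ne h fun e => hrs.ne (Subtype.ext ?_)
      rw [← hγ r, ← hγ s, e]
  · have hzb : z ∈ b := hyb hz.2
    exact ⟨⟨φ z, hφ.monotoneOn hx hzb hz.1, hφ.monotoneOn hzb hy hz.2⟩, huniq _ z hzb rfl⟩

theorem IsBranchwiseReal.exists_between (hX : IsBranchwiseReal X) {x y : X} (hxy : x < y) :
    ∃ w, x < w ∧ w < y := by
  obtain ⟨u, v, huv, γ, hγ, rfl, rfl, -⟩ := hX.exists_parametrization hxy.le
  obtain ⟨r, h1, h2⟩ := _root_.exists_between (hγ.lt_iff_lt.1 hxy)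
  exact ⟨γ r, hγ h1, hγ h2⟩

/-- The values taken by `g` on each interval `[x, y]` include all of `[g x, g y]`. -/
def IntermediateValues (g : X → ℝ) : Prop :=
  ∀ x y, x ≤ y → ∀ t ∈ Set.Icc (g x) (g y), ∃ z ∈ Set.Icc x y, g z = t

/-- The height above a terminal segment `S` of a branch, measured along the branch. -/
theorem IsBranchwiseReal.exists_height (hX : IsBranchwiseReal X) {b : Set X}
    (hb : IsMaxChain (· ≤ ·) b) {S : Set X} (hSb : S ⊆ b)
    (hS : ∀ p ∈ S, ∀ q ∈ b, p ≤ q → q ∈ S) :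
    ∃ g : X → ℝ, Monotone g ∧ (∀ x, g x ∈ Set.Icc 0 4) ∧ IntermediateValues g ∧
      (∀ x, 0 < g x → ∃ p ∈ S, p ≤ x) ∧ StrictMonoOn g S := by
  rcases S.eq_empty_or_nonempty with rfl | hne
  · refine ⟨fun _ => 0, monotone_const, fun _ => by norm_num, fun x y hxy t ht => ?_,
      fun _ h => (lt_irrefl _ h).elim, fun x hx => hx.elim⟩
    exact ⟨x, ⟨le_rfl, hxy⟩, le_antisymm ht.1 ht.2⟩
  obtain ⟨φ, hφ, hφ2, hφI⟩ := hX.exists_coordinate hb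
  choose P hP using hX.exists_isGreatest hb
  have hPmono : ∀ x y, x ≤ y → φ (P x) ≤ φ (P y) := fun x y hxy =>
    hφ.monotoneOn (hP x).1.1 (hP y).1.1 ((hP y).2 ⟨(hP x).1.1, (hP x).1.2.trans hxy⟩)
  have hPb : ∀ w ∈ b, P w = w := fun w hw => le_antisymm (hP w).1.2 ((hP w).2 ⟨hw, le_rfl⟩)
  have hbdd : BddBelow (φ '' S) := ⟨-2, by rintro _ ⟨x, -, rfl⟩; exact (hφ2 x).1⟩
  have hσ : -2 ≤ sInf (φ '' S) := le_csInf (hne.image φ) (by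
    rintro _ ⟨x, -, rfl⟩
    exact (hφ2 x).1)
  have hσS : ∀ w ∈ S, sInf (φ '' S) ≤ φ w := fun w hw => csInf_le hbdd ⟨w, hw, rfl⟩
  generalize hσdef : sInf (φ '' S) = σ at hσ hσS
  -- Project to `b`, then measure from the infimum `σ` of the coordinate on `S`. The bound 4 is the
  -- length of `[-2, 2]`.
  refine ⟨fun x => max 0 (φ (P x) - σ), fun x y hxy => ?_, fun x => ⟨le_max_left _ _, ?_⟩, ?_,
    fun x hx => ?_, fun x hx y hy hxy => ?_⟩
  · exact max_le_max le_rfl (sub_le_sub_right (hPmono x y hxy) _)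
  · have := (hφ2 (P x)).2
    exact max_le (by norm_num) (by linarith)
  · intro x y hxy t ht
    rcases ht.1.eq_or_lt with h | h
    · exact ⟨x, ⟨le_rfl, hxy⟩, h⟩
    have ht0 : 0 < t := (le_max_left _ _).trans_lt h
    have hxt : φ (P x) - σ < t := (le_max_right _ _).trans_lt h
    have hty : t ≤ φ (P y) - σ := (le_max_iff.1 ht.2).resolve_left (not_le.2 ht0)
    obtain ⟨w, hwb, hw⟩ := hφI _ (hP x).1.1 _ (hP y).1.1 (σ + t)
      ⟨by linarith, by linarith⟩
    have hwy : w ≤ y := (le_of_strictMonoOn hb.1 hφ hwb (hP y).1.1 (by linarith)).trans (hP y).1.2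
    refine ⟨w, ⟨?_, hwy⟩, ?_⟩
    · refine ((hX.isChain_Iic y).total hxy hwy).resolve_right fun hwx => ?_
      have := hφ.monotoneOn hwb (hP x).1.1 ((hP x).2 ⟨hwb, hwx⟩)
      linarith
    · simp only [hPb w hwb, hw, add_sub_cancel_left]
      exact max_eq_right ht0.le
  · have h : sInf (φ '' S) < φ (P x) := by
      have := (lt_max_iff.1 hx).resolve_left (lt_irrefl _)
      rw [hσdef]
      linarith
    obtain ⟨_, ⟨q, hq, rfl⟩, hqx⟩ := exists_lt_of_csInf_lt (hne.image φ) h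
    exact ⟨q, hq, (le_of_strictMonoOn hb.1 hφ (hSb hq) (hP x).1.1 hqx.le).trans (hP x).1.2⟩
  · have h1 := hφ (hSb hx) (hSb hy) hxy
    have h2 := hσS x hx
    simp only [hPb x (hSb hx), hPb y (hSb hy)]
    rw [max_eq_right (by linarith), max_eq_right (by linarith)]
    linarith

/-! ### Continuous gradings as sums of heights. -/

theorem IsTreeOrder.isContinuousGrading (hX : IsTreeOrder X) {ℓ : X → ℝ} (hℓ : StrictMono ℓ)
    (hI : IntermediateValues ℓ) : IsContinuousGrading ℓ := by
  refine ⟨hℓ, fun x y hxy => ?_⟩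
  have hlt : ∀ z w : Set.Icc x y, ℓ z ≤ ℓ w → (z : X) ≤ w := fun z w h =>
    ((hX.isChain_Iic y).total z.2.2 w.2.2).elim id fun hwz =>
      (eq_of_le_of_not_lt hwz fun hlt => (hℓ hlt).not_ge h).ge
  let e : Set.Icc x y → Set.Icc (ℓ x) (ℓ y) := fun z =>
    ⟨ℓ z, hℓ.monotone z.2.1, hℓ.monotone z.2.2⟩
  have he : Function.Bijective e := by
    constructor
    · intro z w h
      have h' : ℓ z = ℓ w := congrArg Subtype.val h
      exact Subtype.ext (le_antisymm (hlt z w h'.le) (hlt w z h'.ge))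
    · intro t
      obtain ⟨z, hz, h⟩ := hI x y hxy.le t t.2
      exact ⟨⟨z, hz⟩, Subtype.ext h⟩
  exact ⟨⟨Equiv.ofBijective e he, fun {z w} => ⟨hlt z w, fun h => hℓ.monotone h⟩⟩, fun z => rfl⟩

/-- Along a parametrization of `[x, y]` each `g i` is a monotone surjection onto a real interval,
hence continuous. Since `X` carries no topology, continuity of `ℓ` is expressed through test maps
`γ`. -/
theorem IsBranchwiseReal.intermediateValues_of_continuous (hX : IsBranchwiseReal X) {ι : Type*}
    {g : ι → X → ℝ} (hmono : ∀ i, Monotone (g i)) (hI : ∀ i, IntermediateValues (g i))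
    {ℓ : X → ℝ} (hℓ : ∀ (y : X) (K : Type) [TopologicalSpace K] (γ : K → X), (∀ r, γ r ≤ y) →
      (∀ i, Continuous (g i ∘ γ)) → Continuous (ℓ ∘ γ)) : IntermediateValues ℓ := by
  intro x y hxy t ht
  obtain ⟨u, v, huv, γ, hγ, hu, hv, hsurj⟩ := hX.exists_parametrization hxy
  have hmem : ∀ r, γ r ∈ Set.Icc x y := fun r =>
    ⟨hu ▸ hγ.monotone r.2.1, hv ▸ hγ.monotone r.2.2⟩
  have hcont : Continuous (ℓ ∘ γ) := by
    refine hℓ y _ γ (fun r => (hmem r).2) fun i => ?_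
    let g' : Set.Icc u v → Set.Icc (g i x) (g i y) := fun r =>
      ⟨g i (γ r), hmono i (hmem r).1, hmono i (hmem r).2⟩
    have hg' : Continuous g' := by
      refine Monotone.continuous_of_surjective (fun r s hrs => hmono i (hγ.monotone hrs)) ?_
      intro s
      obtain ⟨z, hz, hzs⟩ := hI i x y hxy s s.2
      obtain ⟨r, rfl⟩ := hsurj z hz
      exact ⟨r, Subtype.ext hzs⟩
    exact continuous_subtype_val.comp hg'
  have : PreconnectedSpace (Set.Icc u v) := Subtype.preconnectedSpace isPreconnected_Icc
  obtain ⟨r, hr⟩ := intermediate_value_univ ⟨u, Set.left_mem_Icc.2 huv⟩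
    ⟨v, Set.right_mem_Icc.2 huv⟩ hcont (by simpa only [Function.comp, hu, hv] using ht)
  exact ⟨γ r, hmem r, hr⟩

/-- A family of bounded monotone functions with the intermediate value property, coloured so that
at every point those of a given colour vanish with at most one exception, can be summed up to a
continuous grading as soon as it separates points. -/
theorem IsBranchwiseReal.continuouslyGradable_of_family (hX : IsBranchwiseReal X) {ι : Type*}
    (g : ι → X → ℝ) (f : ι → ℕ) (hmono : ∀ i, Monotone (g i))
    (hbdd : ∀ i x, g i x ∈ Set.Icc 0 4) (hI : ∀ i, IntermediateValues (g i))
    (hf : ∀ x i j, 0 < g i x → 0 < g j x → f i = f j → i = j)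
    (hsep : ∀ x y, x < y → ∃ i, g i x < g i y) : ContinuouslyGradable X := by
  -- The majorant for the M-test on all points below `y`. It is summable because `f` is injective on
  -- the indices with `0 < g i y`.
  let u : X → ι → ℝ := fun y => Set.indicator {i | 0 < g i y} fun i => (1 / 2) ^ f i * 4
  have hu : ∀ y, Summable (u y) := by
    intro y
    rw [← summable_subtype_iff_indicator]
    have hinj : Function.Injective fun i : {i | 0 < g i y} => f i :=
      fun i j h => Subtype.ext (hf y i j i.2 j.2 h)
    exact (summable_geometric_two.comp_injective hinj).mul_right 4
  have hpow : ∀ i, (0 : ℝ) < (1 / 2) ^ f i := fun i => by positivity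
  have hle : ∀ y z i, z ≤ y → ‖(1 / 2 : ℝ) ^ f i * g i z‖ ≤ u y i := by
    intro y z i hzy
    rw [Real.norm_of_nonneg (mul_nonneg (hpow i).le (hbdd i z).1)]
    by_cases h : 0 < g i y
    · rw [show u y i = (1 / 2) ^ f i * 4 from Set.indicator_of_mem (by exact h) _]
      exact mul_le_mul_of_nonneg_left (hbdd i z).2 (hpow i).le
    · rw [show u y i = 0 from Set.indicator_of_notMem (by exact h) _]
      have : g i z ≤ 0 := (hmono i hzy).trans (not_lt.1 h)
      exact mul_nonpos_of_nonneg_of_nonpos (hpow i).le this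
  have hsum : ∀ y, Summable fun i => (1 / 2 : ℝ) ^ f i * g i y := fun y =>
    Summable.of_norm_bounded (hu y) fun i => hle y y i le_rfl
  refine ⟨fun y => ∑' i, (1 / 2) ^ f i * g i y, hX.isContinuousGrading (fun x y hxy => ?_) ?_⟩
  · obtain ⟨i, hi⟩ := hsep x y hxy
    exact Summable.tsum_lt_tsum
      (fun j => mul_le_mul_of_nonneg_left (hmono j hxy.le) (hpow j).le)
      (mul_lt_mul_of_pos_left hi (hpow i)) (hsum x) (hsum y)
  · refine hX.intermediateValues_of_continuous hmono hI fun y K _ γ hγ hc => ?_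
    exact continuous_tsum (fun i => continuous_const.mul (hc i)) (hu y)
      fun i r => hle y (γ r) i (hγ r)

end Branches

/-! ### Least branches and the relation between them. -/

/-- A choice of a branch through every point, least with respect to an injective ranking. -/
structure LeastBranch (X : Type u) [PartialOrder X] where
  rank : Set X → Ordinal.{u}
  branch : X → Set X
  rank_injective : Function.Injective rank
  isMaxChain : ∀ x, IsMaxChain (· ≤ ·) (branch x)
  mem : ∀ x, x ∈ branch x
  rank_le : ∀ x b, IsMaxChain (· ≤ ·) b → x ∈ b → rank (branch x) ≤ rank b

theorem IsTreeOrder.nonempty_leastBranch {X : Type u} [PartialOrder X] (hX : IsTreeOrder X) :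
    Nonempty (LeastBranch X) := by
  let ρ : Set X → Ordinal.{u} := fun b => Ordinal.typein WellOrderingRel b
  have h : ∀ x, ∃ b, (IsMaxChain (· ≤ ·) b ∧ x ∈ b) ∧
      ∀ b', IsMaxChain (· ≤ ·) b' → x ∈ b' → ρ b ≤ ρ b' := by
    intro x
    obtain ⟨b, hb, hxb⟩ := hX.exists_branch x
    obtain ⟨c, hc, hmin⟩ := (InvImage.wf ρ Ordinal.lt_wf).has_min
      {b | IsMaxChain (· ≤ ·) b ∧ x ∈ b} ⟨b, hb, hxb le_rfl⟩
    exact ⟨c, hc, fun b' h1 h2 => not_lt.1 (hmin b' ⟨h1, h2⟩)⟩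
  choose β hβ hmin using h
  exact ⟨⟨ρ, β, Ordinal.typein_injective _, fun x => (hβ x).1, fun x => (hβ x).2, hmin⟩⟩

/-- Every element except a last one has a gap above it, up to its successor, and only countably many
points have such gaps. -/
theorem countable_of_isWF {V : Set ℝ} (hV : V.IsWF) : V.Countable := by
  refine Set.Countable.of_sdiff (Set.Subsingleton.countable ?_)
    (countable_image_lt_image_Ioi_within V id)
  have key : ∀ r ∈ V, ∀ s ∈ V, r < s → ∃ z, id r < z ∧ ∀ y ∈ V, r < y → z ≤ id y := by
    intro r hr s hs hrs
    have hne : (V ∩ Set.Ioi r).Nonempty := ⟨s, hs, hrs⟩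
    have hwf : (V ∩ Set.Ioi r).IsWF := hV.mono Set.inter_subset_left
    exact ⟨hwf.min hne, (hwf.min_mem hne).2, fun y hy hry => hwf.min_le hne ⟨hy, hry⟩⟩
  rintro r ⟨hr, hr'⟩ s ⟨hs, hs'⟩
  rcases lt_trichotomy r s with h | h | h
  · exact (hr' ⟨hr, key r hr s hs h⟩).elim
  · exact h
  · exact (hs' ⟨hs, key s hs r hr h⟩).elim

namespace LeastBranch

variable {X : Type u} [PartialOrder X] (c : LeastBranch X)

/-- Some point whose chosen branch is `b` lies below one whose chosen branch is `b' ≠ b`. -/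
def Rel (b b' : Set X) : Prop :=
  b ≠ b' ∧ ∃ p q, c.branch p = b ∧ c.branch q = b' ∧ p ≤ q

variable {c}

theorem rank_mono (hX : IsTreeOrder X) {p q : X} (h : p ≤ q) :
    c.rank (c.branch p) ≤ c.rank (c.branch q) :=
  c.rank_le p _ (c.isMaxChain q) (hX.mem_of_le (c.isMaxChain q) (c.mem q) h)

/-- Ranks only grow upwards, and the branch of `p` is a candidate for `q`. Thus the points choosing
a branch form a terminal segment of it. -/
theorem branch_eq_of_mem (hX : IsTreeOrder X) {p q : X} (h : p ≤ q) (hq : q ∈ c.branch p) :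
    c.branch q = c.branch p :=
  c.rank_injective ((c.rank_le q _ (c.isMaxChain p) hq).antisymm (c.rank_mono hX h))

theorem Rel.rank_lt (hX : IsTreeOrder X) {b b' : Set X} (h : c.Rel b b') :
    c.rank b < c.rank b' := by
  obtain ⟨hne, p, q, rfl, rfl, hpq⟩ := h
  exact lt_of_le_of_ne (c.rank_mono hX hpq) fun e => hne (c.rank_injective e)

/-- Both `z` and `q` lie on one branch, so `z` is comparable to `p`, and `z ≤ p` would make the rank
drop. So one point below a segment is below all of it. -/
theorem lt_of_branch_eq (hX : IsTreeOrder X) {p q z : X} (h : p ≤ q)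
    (hne : c.branch p ≠ c.branch q) (hz : c.branch z = c.branch q) : p < z := by
  have hlt : c.rank (c.branch p) < c.rank (c.branch q) :=
    Rel.rank_lt hX ⟨hne, p, q, rfl, rfl, h⟩
  have hzp : ¬ z ≤ p := fun hzp => by
    have := c.rank_mono hX hzp
    rw [hz] at this
    exact this.not_gt hlt
  have hzq : z ∈ c.branch q := hz ▸ c.mem z
  have hpz : p ≤ z := by
    rcases (c.isMaxChain q).1.total hzq (c.mem q) with h1 | h1
    · exact ((hX.isChain_Iic q).total h h1).resolve_right hzp
    · exact h.trans h1
  exact lt_of_le_of_ne hpz fun e => hzp e.ge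

theorem Rel.total_of_common (hX : IsTreeOrder X) {a b d : Set X} (ha : c.Rel a d)
    (hb : c.Rel b d) : a = b ∨ c.Rel a b ∨ c.Rel b a := by
  obtain ⟨hne, p, q, rfl, rfl, hpq⟩ := ha
  obtain ⟨-, p', q', rfl, hq', hpq'⟩ := hb
  have h := c.lt_of_branch_eq hX hpq hne hq'
  by_cases hab : c.branch p = c.branch p'
  · exact Or.inl hab
  refine Or.inr (((hX.isChain_Iic q').total h.le hpq').imp (fun h => ?_) fun h => ?_)
  · exact ⟨hab, p, p', rfl, rfl, h⟩
  · exact ⟨Ne.symm hab, p', p, rfl, rfl, h⟩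

theorem countable_of_pairwise_rel (hX : IsBranchwiseReal X) {C : Set (Set X)}
    (hC : C.Pairwise fun a b => c.Rel a b ∨ c.Rel b a) : C.Countable := by
  let C' : Set (Set X) := {b ∈ C | ∃ b' ∈ C, c.Rel b b'}
  have hmax : (C \ C').Subsingleton := by
    rintro a ⟨ha, ha'⟩ b ⟨hb, hb'⟩
    by_contra hne
    rcases hC ha hb hne with h | h
    exacts [ha' ⟨ha, b, hb, h⟩, hb' ⟨hb, a, ha, h⟩]
  refine hmax.countable.of_sdiff ?_
  have hlt : ∀ a ∈ C, ∀ b ∈ C, c.rank a < c.rank b → c.Rel a b := fun a ha b hb h =>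
    (hC ha hb fun e => h.ne (congrArg _ e)).resolve_right fun h' => (h'.rank_lt hX.1).not_gt h
  have hx : ∀ b : C', ∃ x, c.branch x = b ∧ ∀ b' ∈ C, c.Rel b b' →
      ∀ z, c.branch z = b' → x < z := by
    rintro ⟨b, hb, hb'⟩
    -- With `s` the next branch after `b` in `C`, a point of `b` below the segment of `s` is below
    -- all later segments too.
    obtain ⟨s, ⟨hs, hbs⟩, hmin⟩ := (InvImage.wf c.rank Ordinal.lt_wf).has_min
      {s | s ∈ C ∧ c.Rel b s} hb'
    obtain ⟨hne, p, q, rfl, rfl, hpq⟩ := hbs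
    refine ⟨p, rfl, fun b' hb'C hpb' z hz => ?_⟩
    by_cases hqb : c.branch q = b'
    · exact c.lt_of_branch_eq hX.1 hpq hne (hz.trans hqb.symm)
    · have hr : c.rank (c.branch q) < c.rank b' :=
        lt_of_le_of_ne (not_lt.1 (hmin b' ⟨hb'C, hpb'⟩)) fun e => hqb (c.rank_injective e)
      obtain ⟨-, p', q', hp', rfl, hpq'⟩ := hlt _ hs _ hb'C hr
      have h1 := (c.lt_of_branch_eq hX.1 hpq hne hp').le.trans hpq'
      exact c.lt_of_branch_eq hX.1 h1 hpb'.1 hz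
  choose x hxb hx using hx
  have hxlt : ∀ a b : C', c.rank a < c.rank b → x a < x b := fun a b h =>
    hx a b b.2.1 (hlt _ a.2.1 _ b.2.1 h) _ (hxb b)
  have htri : ∀ a b : C', a ≠ b → c.rank a < c.rank b ∨ c.rank b < c.rank a := fun a b h =>
    lt_or_gt_of_ne fun e => h (Subtype.ext (c.rank_injective e))
  have hch : IsChain (· ≤ ·) (Set.range x) := by
    rintro _ ⟨a, rfl⟩ _ ⟨b, rfl⟩ hne
    exact (htri a b fun e => hne (e ▸ rfl)).imp (fun h => (hxlt a b h).le)
      fun h => (hxlt b a h).le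
  obtain ⟨M, hM, hxM⟩ := hch.exists_maxChain
  obtain ⟨φ, hφ, -⟩ := hX.exists_coordinate hM
  have hvlt : ∀ a b : C', c.rank a < c.rank b → φ (x a) < φ (x b) := fun a b h =>
    hφ (hxM ⟨a, rfl⟩) (hxM ⟨b, rfl⟩) (hxlt a b h)
  have hinj : Function.Injective fun a => φ (x a) := by
    intro a b h
    by_contra hne
    exact (htri a b hne).elim (fun h' => (hvlt a b h').ne h) fun h' => (hvlt b a h').ne' h
  have hwf : (Set.range fun a => φ (x a)).IsWF := by
    choose k hk using fun r : Set.range fun a => φ (x a) => r.2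
    refine Subrelation.wf (r := InvImage (· < ·) fun r => c.rank (k r)) ?_
      (InvImage.wf _ Ordinal.lt_wf)
    intro r s hrs
    have hrs' : (r : ℝ) < s := hrs
    rw [← hk r, ← hk s] at hrs'
    by_contra hge
    rcases htri (k r) (k s) (fun e => hrs'.ne (by simp only [e])) with h | h
    · exact hge h
    · exact hrs'.not_gt (hvlt _ _ h)
  have hc : Countable C' := by
    have := (countable_of_isWF hwf).to_subtype
    exact (Set.rangeFactorization_injective.2 hinj).countable
  exact Set.countable_coe_iff.1 hc

/-- The node is the meet at which `q` leaves the branch chosen by `p`. It lies above `p` on that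
branch, so it chooses the same one, and different `b` get different nodes. -/
theorem Rel.exists_branchingNode (hX : IsBranchwiseReal X) {b b' : Set X} (h : c.Rel b b') :
    ∃ m ∈ branchingNodes X, c.branch m = b := by
  obtain ⟨hne, p, q, rfl, rfl, hpq⟩ := h
  have hq : q ∉ c.branch p := fun hq => hne (c.branch_eq_of_mem hX.1 hpq hq).symm
  obtain ⟨d, hd, hdq⟩ := exists_mem_not_le_of_notMem (c.isMaxChain p) hq
  obtain ⟨m, hm⟩ := hX.exists_meet d q
  have hmd : m ≤ d := hm.1 (by simp)
  have hmq : m ≤ q := hm.1 (by simp)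
  have hmb : m ∈ c.branch p := hX.mem_of_le (c.isMaxChain p) hd hmd
  have hpd : p ≤ d := ((c.isMaxChain p).1.total (c.mem p) hd).resolve_right
    fun h => hdq (h.trans hpq)
  have hpm : p ≤ m := hm.2 (by
    rintro z (rfl | rfl)
    exacts [hpd, hpq])
  refine ⟨m, ?_, c.branch_eq_of_mem hX.1 hpm hmb⟩
  have hmd' : m < d := lt_of_le_of_ne hmd fun e => hdq (e ▸ hmq)
  have hmq' : m < q := lt_of_le_of_ne hmq fun e => hq (e ▸ hmb)
  refine Cardinal.one_lt_iff_nontrivial.2 ⟨⟨_, ⟨d, hmd'⟩, rfl⟩, ⟨_, ⟨q, hmq'⟩, rfl⟩, fun e => ?_⟩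
  have hmem : (⟨q, hmq'⟩ : Set.Ioi m) ∈ {z | ConnectedAbove m ⟨d, hmd'⟩ z} := by
    exact (congrArg (fun C => (⟨q, hmq'⟩ : Set.Ioi m) ∈ C.1) e).mpr
      ((hX.equivalence_connectedAbove m).refl _)
  obtain ⟨w, hmw, hwd, hwq⟩ := hmem
  refine hmw.not_ge (hm.2 ?_)
  rintro z (rfl | rfl)
  exacts [hwd, hwq]

/-- Under Martin's Axiom, the chosen branches can be coloured by natural numbers so that related
branches get different colours. -/
theorem exists_coloring (c : LeastBranch X) {κ : Cardinal.{u}} (hMA : MartinsAxiom κ)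
    (hX : IsBranchwiseReal X) (hκ : #(branchingNodes X) ≤ κ) :
    ∃ f : Set X → ℕ, ∀ b b', c.Rel b b' → f b ≠ f b' := by
  classical
  let T : Set (Set X) := {b | ∃ b', c.Rel b b'}
  have hT : #T ≤ κ := by
    choose m hmB hm using fun b : T => b.2.choose_spec.exists_branchingNode hX
    refine (Cardinal.mk_le_of_injective (f := fun b : T => (⟨m b, hmB b⟩ : branchingNodes X))
      fun a b h => Subtype.ext ?_).trans hκ
    have hab : m a = m b := congrArg Subtype.val h
    rw [← hm a, ← hm b, hab]
  obtain ⟨f, hf⟩ := hMA.exists_coloring hT (R := fun a b => c.Rel a b) (fun a h => h.1 rfl)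
    (fun a b d ha hb => (Rel.total_of_common hX.1 ha hb).imp_left Subtype.ext) (by
      intro C hC
      refine Set.countable_of_injective_of_countable_image
        (f := ((↑) : T → Set X)) Subtype.val_injective.injOn
        (c.countable_of_pairwise_rel hX ?_)
      rintro _ ⟨a, ha, rfl⟩ _ ⟨b, hb, rfl⟩ hne
      exact hC ha hb fun e => hne (e ▸ rfl))
  -- Branches outside `T` have no successor, so they are never related to each other and can share
  -- the colour 0.
  refine ⟨fun b => if h : b ∈ T then f ⟨b, h⟩ + 1 else 0, fun b b' h => ?_⟩
  have hb : b ∈ T := ⟨b', h⟩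
  by_cases hb' : b' ∈ T
  · simpa [hb, hb'] using hf ⟨b, hb⟩ ⟨b', hb'⟩ h
  · simp [hb, hb']

end LeastBranch

/-! ### The grading. -/

theorem MartinsAxiom.continuouslyGradable {κ : Cardinal.{u}} (hMA : MartinsAxiom κ)
    {X : Type u} [PartialOrder X] (hX : IsBranchwiseReal X) (hκ : #(branchingNodes X) ≤ κ) :
    ContinuouslyGradable X := by
  obtain ⟨c⟩ := hX.nonempty_leastBranch
  obtain ⟨f, hf⟩ := c.exists_coloring hMA hX hκ
  choose g hmono hbdd hI hsupp hstrict using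
    fun b : {b : Set X // IsMaxChain (· ≤ ·) b} => hX.exists_height b.2
      (S := {p | c.branch p = b}) (by rintro p hp; exact hp ▸ c.mem p) (by
        rintro p hp q hq hpq
        have hp' : c.branch p = b := hp
        exact (c.branch_eq_of_mem hX.1 hpq (by rwa [hp'])).trans hp')
  refine hX.continuouslyGradable_of_family g (fun b => f b) hmono hbdd hI ?_ ?_
  · intro x b b' hb hb' hfb
    obtain ⟨p, hp, hpx⟩ := hsupp b x hb
    obtain ⟨p', hp', hpx'⟩ := hsupp b' x hb'
    by_contra hne
    have hne' : (b : Set X) ≠ b' := fun e => hne (Subtype.ext e)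
    rcases (hX.isChain_Iic x).total hpx hpx' with h | h
    · exact hf _ _ ⟨hne', p, p', hp, hp', h⟩ hfb
    · exact hf _ _ ⟨hne'.symm, p', p, hp', hp, h⟩ hfb.symm
  · intro x y hxy
    -- By minimality of the rank at `z`, all of `(x, z]` chooses the branch of `z`, and the height
    -- for that branch increases strictly there.
    obtain ⟨z, hz, hmin⟩ := (InvImage.wf (fun z => c.rank (c.branch z)) Ordinal.lt_wf).has_min
      (Set.Ioc x y) ⟨y, hxy, le_rfl⟩
    obtain ⟨w, hxw, hwz⟩ := hX.exists_between hz.1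
    have hw : c.branch w = c.branch z := c.rank_injective
      ((c.rank_mono hX.1 hwz.le).antisymm (not_lt.1 (hmin w ⟨hxw, hwz.le.trans hz.2⟩)))
    let b : {b : Set X // IsMaxChain (· ≤ ·) b} := ⟨c.branch z, c.isMaxChain z⟩
    exact ⟨b, ((hmono b hxw.le).trans_lt (hstrict b hw rfl hwz)).trans_le (hmono b hz.2)⟩

end TreeOrder

theorem theorem5p10 (κ : Cardinal.{u}) (hMA : TreeOrder.MartinsAxiom κ) :
    (∀ (X : Type u) [PartialOrder X], TreeOrder.IsBranchwiseReal X →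
      #(TreeOrder.branchingNodes X) ≤ κ → TreeOrder.ContinuouslyGradable X) ∧
    (∀ (X : Type u) [PartialOrder X], TreeOrder.IsBranchwiseReal X →
      TreeOrder.IsWispy κ X → TreeOrder.ContinuouslyGradable X) :=
  ⟨fun _ _ hX hκ => hMA.continuouslyGradable hX hκ,
    fun _ _ hX hκ => hMA.continuouslyGradable hX hκ.1.le⟩
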